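/- Let $n\ge 2$. Write $x\in\mathbb R^n$ as $x=(x',x_n)=(x_1,x'',x_n)$ with $x''\in\mathbb R^{n-2}$ (so $x''$ is absent and $|x''|=0$ if $n=2$), let $B_1^+=\{x\in\mathbb R^n: |x|<1,\ x_n>0\}$, and let $B_1'$ be the open unit ball of $\mathbb R^{n-1}$ centred at $0$. For a convex $u\in C(\overline{B_1^+})$ and $x\in B_1^+$ let $\partial u(x)=\{p\in\mathbb R^n: u(y)\ge u(x)+p\cdot(y-x)\ \text{for all } y\in B_1^+\}$. The inequalities $\lambda\le\det D^2u\le\Lambda$ in $B_1^+$ are understood in the generalized (Alexandrov) sense, that is, $\lambda|E|\le\big|\bigcup_{x\in E}\partial u(x)\big|\le\Lambda|E|$ for every Borel set $E\subset B_1^+$, where $|\cdot|$ is Lebesgue measure. For $x'\in B_1'$ put $$D_nu(x',0)=\limsup_{t\to0^+}\ \sup\{p_n: p\in\partial u(x',t)\}\in[-\infty,\infty].$$ **Lemma 4.1 (Strict convexity lemma).** Given positive constants $H,M_1,M_2,\lambda,\Lambda$, there exists $\sigma=\sigma(H,M_1,M_2,\lambda,\Lambda,n)>0$ such that the following holds.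 If $u\in C(\overline{B_1^+})$ is a convex function with $$\lambda\le\det D^2u\le\Lambda\ \text{ in } B_1^+,\qquad D_nu(x',0)\ge-M_2\ \text{ for all } x'\in B_1',$$ and $$0\le u(x_1,x'',0)\le\sigma+M_1|x''|^2\ \text{ for all } (x_1,x'')\in B_1',$$ then $$\sup_{B_1^+}u\ge H.$$ -/

import Mathlib

open Set Filter Topology MeasureTheory

/-- The subdifferential at `x` of a function `u` on `Ω`: the slopes `p` of the affine functions
`y ↦ u x + p · (y - x)` that support the graph of `u` over `Ω` from below at `x`. -/
def subdifferentialOn {n : ℕ} (Ω : Set (EuclideanSpace ℝ (Fin n)))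
    (u : EuclideanSpace ℝ (Fin n) → ℝ) (x : EuclideanSpace ℝ (Fin n)) :
    Set (EuclideanSpace ℝ (Fin n)) :=
  {p | ∀ y ∈ Ω, u x + inner ℝ p (y - x) ≤ u y}

/-- The Monge-Ampère measure of `u` in `Ω` on a set `E ⊆ Ω`: the Lebesgue measure of the
subgradient image `∂u(E)`. -/
noncomputable def mongeAmpereOn {n : ℕ} (Ω : Set (EuclideanSpace ℝ (Fin n)))
    (u : EuclideanSpace ℝ (Fin n) → ℝ) (E : Set (EuclideanSpace ℝ (Fin n))) : ENNReal :=
  volume (⋃ x ∈ E, subdifferentialOn Ω u x)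

/-- `lam ≤ det D²u ≤ Lam` in `Ω` in the generalized (Alexandrov) sense: the Monge-Ampère measure
of `u` lies between `lam` and `Lam` times Lebesgue measure on the Borel subsets of `Ω`. -/
def DetHessianBetween {n : ℕ} (Ω : Set (EuclideanSpace ℝ (Fin n)))
    (u : EuclideanSpace ℝ (Fin n) → ℝ) (lam Lam : ℝ) : Prop :=
  ∀ E : Set (EuclideanSpace ℝ (Fin n)), MeasurableSet E → E ⊆ Ω →
    ENNReal.ofReal lam * volume E ≤ mongeAmpereOn Ω u E ∧
      mongeAmpereOn Ω u E ≤ ENNReal.ofReal Lam * volume E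

/-! Below the dimension is `n = m + 2`. The coordinates of `x` are `x₁ = x 0`, the `m` middle
coordinates `x''` (none if `n = 2`), and `xₙ = x (Fin.last (m + 1))`. -/

/-- The open half ball `B₁⁺`. -/
def unitHalfBall (m : ℕ) : Set (EuclideanSpace ℝ (Fin (m + 2))) :=
  {x | x ∈ Metric.ball 0 1 ∧ 0 < x (Fin.last (m + 1))}

/-- The flat boundary `B₁' × {0}`. -/
def unitFlatBall (m : ℕ) : Set (EuclideanSpace ℝ (Fin (m + 2))) :=
  {x | x ∈ Metric.ball 0 1 ∧ x (Fin.last (m + 1)) = 0}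

/-- `|x''|²`. -/
def middleNormSq {m : ℕ} (x : EuclideanSpace ℝ (Fin (m + 2))) : ℝ :=
  ∑ i : Fin m, x i.castSucc.succ ^ 2

/-- `Dₙu(x)`, read as `sup {pₙ : p ∈ ∂u(x)}` where `u` need not be differentiable. -/
noncomputable def upperNormalDerivOn {m : ℕ} (Ω : Set (EuclideanSpace ℝ (Fin (m + 2))))
    (u : EuclideanSpace ℝ (Fin (m + 2)) → ℝ) (x : EuclideanSpace ℝ (Fin (m + 2))) : EReal :=
  ⨆ p ∈ subdifferentialOn Ω u x, ((p (Fin.last (m + 1)) : ℝ) : EReal)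

/-- `Dₙu(x', 0) = limsup_{t → 0⁺} Dₙu(x', t)` at the boundary point `x = (x', 0)`. The value `-∞` is
possible, hence the extended reals. -/
noncomputable def boundaryNormalDeriv {m : ℕ} (u : EuclideanSpace ℝ (Fin (m + 2)) → ℝ)
    (x : EuclideanSpace ℝ (Fin (m + 2))) : EReal :=
  limsup (fun t : ℝ => upperNormalDerivOn (unitHalfBall m) u
    (x + t • EuclideanSpace.single (Fin.last (m + 1)) 1)) (𝓝[>] (0 : ℝ))

/-! Suppose `u` stays below `H`. Convexity along vertical segments gives `u ≤ σ + M₁|x''|² + 2H xₙ`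
in a box. This bound is improved by the barrier `w = σ + 2M₁|x''|² + b x₁² xₙ + κ xₙ log(2(xₙ + σ))
+ 2H xₙ` with `b = 4κ log(1/(2σ))`. On the boundary of the box `w` lies above `u`, the `x₁²` term
beating the negative logarithm on the faces `|x₁| = 1/2`. Where `D²w ≥ 0`, its determinant is at
most the product of its diagonal, of order `κ² log(1/σ)`, which the choice of `κ` keeps below `lam`.
Hence `u ≤ w` by comparison (`le_of_mongeAmpereOn_ge`, `le_barrier`). On the `xₙ` axis the extra
slope `κ log(2(xₙ + σ))` has size about `√(log(1/σ))` when `xₙ` is near `√σ`, so it is as negative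
as desired (`exists_logProfile_parameters`). Then `u` falls along the axis faster than `u(0) ≥ 0`
and the bound on `Dₙu(0)` allow (`le_of_lt_boundaryNormalDeriv`). -/

/-! ### Comparison principle for Alexandrov subsolutions. -/

/-- The second-order necessary condition at a local minimum of a function of one variable. -/
theorem IsLocalMin.second_deriv_nonneg {φ φ' : ℝ → ℝ} {a c : ℝ} (hmin : IsLocalMin φ a)
    (hφ : ∀ᶠ s in 𝓝 a, HasDerivAt φ (φ' s) s) (hφ' : HasDerivAt φ' c a) : 0 ≤ c := by
  by_contra! hc
  have hd : deriv φ =ᶠ[𝓝 a] φ' := hφ.mono fun s hs => hs.deriv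
  have hdd : deriv (deriv φ) a = c := by rw [hd.deriv_eq, hφ'.deriv]
  -- If `c < 0`, the point is a local maximum as well, so `φ` is locally constant and `c = 0`.
  have hmax : IsLocalMax φ a :=
    isLocalMax_of_deriv_deriv_neg (hdd ▸ hc) hmin.deriv_eq_zero hφ.self_of_nhds.continuousAt
  have hconst : φ =ᶠ[𝓝 a] fun _ => φ a := by
    filter_upwards [hmin, hmax] with s h₁ h₂ using le_antisymm h₂ h₁
  have h0 : deriv φ =ᶠ[𝓝 a] fun _ => 0 := by
    simpa using hconst.deriv
  have : deriv (deriv φ) a = 0 := by rw [h0.deriv_eq]; simp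
  linarith

/-- At a local minimum of `w - ⟨p, ·⟩` the gradient of `w` is `p` and its Hessian is positive
semidefinite. -/
theorem gradient_eq_and_hessian_nonneg_of_isLocalMin {n : ℕ} {w : EuclideanSpace ℝ (Fin n) → ℝ}
    {P : EuclideanSpace ℝ (Fin n) → EuclideanSpace ℝ (Fin n)}
    {T : EuclideanSpace ℝ (Fin n) →L[ℝ] EuclideanSpace ℝ (Fin n)} {p z : EuclideanSpace ℝ (Fin n)}
    (hmin : IsLocalMin (fun x => w x - inner ℝ p x) z)
    (hw : ∀ᶠ x in 𝓝 z, HasFDerivAt w (innerSL ℝ (P x)) x) (hP : HasFDerivAt P T z) :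
    P z = p ∧ ∀ v, 0 ≤ inner ℝ (T v) v := by
  have hgrad : ∀ x, HasFDerivAt w (innerSL ℝ (P x)) x →
      HasFDerivAt (fun x => w x - inner ℝ p x) (innerSL ℝ (P x - p)) x := by
    intro x hx
    have := hx.sub (innerSL ℝ p).hasFDerivAt
    rw [map_sub]
    exact this
  refine ⟨?_, fun v => ?_⟩
  · have h := hmin.hasFDerivAt_eq_zero (hgrad z hw.self_of_nhds)
    have h2 := congrArg (fun f => f (P z - p)) h
    simp only [innerSL_apply_apply, zero_apply, inner_self_eq_zero] at h2
    exact sub_eq_zero.mp h2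
  · have hline : ∀ s : ℝ, HasDerivAt (fun s : ℝ => z + s • v) v s := fun s => by
      simpa using ((hasDerivAt_id s).smul_const v).const_add z
    have ht : Tendsto (fun s : ℝ => z + s • v) (𝓝 0) (𝓝 z) := by
      simpa using (hline 0).continuousAt.tendsto
    have hz : z + (0 : ℝ) • v = z := by simp
    refine IsLocalMin.second_deriv_nonneg (φ := fun s : ℝ => w (z + s • v) - inner ℝ p (z + s • v))
      (φ' := fun s => inner ℝ (P (z + s • v) - p) v) (a := 0) ?_ ?_ ?_
    · have := ht.eventually hmin
      simpa [IsLocalMin, IsMinFilter] using this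
    · filter_upwards [ht.eventually hw] with s hs
      exact (hgrad _ hs).comp_hasDerivAt s (hline s)
    · have h1 : HasDerivAt (fun s : ℝ => P (z + s • v) - p) (T v) 0 := by
        refine HasDerivAt.sub_const p ?_
        exact HasFDerivAt.comp_hasDerivAt (0 : ℝ) (hz.symm ▸ hP) (hline 0)
      simpa using h1.inner ℝ (hasDerivAt_const (0 : ℝ) v)

/-- Comparison principle: a convex function whose Monge-Ampère measure is at least `lam` stays below
a `C²` function `w` that dominates it off `V` and whose Hessian determinant is less than `lam` in
`V` wherever the Hessian is positive semidefinite. -/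
theorem le_of_mongeAmpereOn_ge {n : ℕ} {Ω K V : Set (EuclideanSpace ℝ (Fin n))}
    {u w : EuclideanSpace ℝ (Fin n) → ℝ}
    {P : EuclideanSpace ℝ (Fin n) → EuclideanSpace ℝ (Fin n)}
    {T : EuclideanSpace ℝ (Fin n) → EuclideanSpace ℝ (Fin n) →L[ℝ] EuclideanSpace ℝ (Fin n)}
    {lam μ : ℝ} (hK : IsCompact K) (hKΩ : K ⊆ closure Ω) (hV : IsOpen V) (hVK : V ⊆ K)
    (hVΩ : V ⊆ Ω) (hu : ContinuousOn u (closure Ω)) (hw : ContinuousOn w K)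
    (hMA : ∀ E, MeasurableSet E → E ⊆ Ω → ENNReal.ofReal lam * volume E ≤ mongeAmpereOn Ω u E)
    (hlam : 0 < lam) (hμ : μ < lam) (hbdry : ∀ x ∈ K \ V, u x ≤ w x)
    (hP : ∀ x ∈ V, HasFDerivAt w (innerSL ℝ (P x)) x) (hT : ∀ x ∈ V, HasFDerivAt P (T x) x)
    (hdet : ∀ x ∈ V, (∀ v, 0 ≤ inner ℝ (T x v) v) → |(T x).det| ≤ μ) :
    ∀ x ∈ K, u x ≤ w x := by
  by_contra! hcon
  obtain ⟨x₀, hx₀K, hx₀⟩ := hcon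
  have huV : ContinuousOn u V := hu.mono (hVK.trans hKΩ)
  have hwV : ContinuousOn w V := hw.mono hVK
  set G : Set (EuclideanSpace ℝ (Fin n)) := {x ∈ V | w x < u x} with hG
  have hGV : G ⊆ V := fun x hx => hx.1
  have hGo : IsOpen G := by
    have := (huV.sub hwV).isOpen_inter_preimage hV isOpen_Ioi (t := Ioi 0)
    convert this using 1
    ext x
    simp [hG]
  have hGne : G.Nonempty := by
    refine ⟨x₀, ?_, hx₀⟩
    by_contra hxV
    exact absurd (hbdry x₀ ⟨hx₀K, hxV⟩) (not_le.mpr hx₀)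
  -- Phrased with `fderiv`, whose measurability is automatic; nothing is assumed on how `T x`
  -- depends on `x`.
  set S : Set (EuclideanSpace ℝ (Fin n)) := G ∩ {x | |(fderiv ℝ P x).det| ≤ μ} with hS
  have hSm : MeasurableSet S := by
    refine hGo.measurableSet.inter (measurableSet_le ?_ measurable_const)
    exact (ContinuousLinearMap.continuous_det.measurable.comp (measurable_fderiv ℝ P)).abs
  have hsub : (⋃ x ∈ G, subdifferentialOn Ω u x) ⊆ P '' S := by
    intro p hp
    simp only [mem_iUnion, exists_prop] at hp
    obtain ⟨y, hy, hp⟩ := hp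
    have hp' : ∀ x ∈ closure Ω, u y + inner ℝ p (x - y) ≤ u x := fun x hx =>
      le_on_closure hp (by fun_prop) hu hx
    -- Slide the plane of slope `p` until it touches `w`: at the contact point `w z - p·z ≤ w y -
    -- p·y < u y - p·y ≤ u z - p·z`, so `z` lies in `G`.
    obtain ⟨z, hzK, hz⟩ := hK.exists_isMinOn ⟨y, hVK (hGV hy)⟩
      (f := fun x => w x - inner ℝ p x) (hw.sub (by fun_prop))
    have hzu : w z < u z := by
      have h1 := hz (hVK (hGV hy))
      have h2 := hp' z (hKΩ hzK)
      have h3 := hy.2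
      simp only [mem_ofPred_eq] at h1
      rw [inner_sub_right] at h2
      linarith
    have hzV : z ∈ V := by
      by_contra hzV
      exact absurd (hbdry z ⟨hzK, hzV⟩) (not_le.mpr hzu)
    have hVn := hV.mem_nhds hzV
    obtain ⟨h1, h2⟩ := gradient_eq_and_hessian_nonneg_of_isLocalMin
      (hz.isLocalMin (mem_of_superset hVn hVK)) (mem_of_superset hVn hP) (hT z hzV)
    refine ⟨z, ⟨⟨hzV, hzu⟩, ?_⟩, h1⟩
    simpa [(hT z hzV).fderiv] using hdet z hzV h2
  have hvol : volume (P '' S) ≤ ENNReal.ofReal μ * volume G := by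
    calc volume (P '' S) ≤ ∫⁻ x in S, ENNReal.ofReal |(fderiv ℝ P x).det| :=
          addHaar_image_le_lintegral_abs_det_fderiv volume hSm fun x hx =>
            (hT x hx.1.1).differentiableAt.hasFDerivAt.hasFDerivWithinAt
      _ ≤ ∫⁻ _ in S, ENNReal.ofReal μ :=
          setLIntegral_mono measurable_const fun x hx => ENNReal.ofReal_le_ofReal hx.2
      _ = ENNReal.ofReal μ * volume S := setLIntegral_const _ _
      _ ≤ ENNReal.ofReal μ * volume G := by gcongr; exact inter_subset_left
  have hle : ENNReal.ofReal lam * volume G ≤ ENNReal.ofReal μ * volume G :=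
    (hMA G hGo.measurableSet (hGV.trans hVΩ)).trans ((measure_mono hsub).trans hvol)
  have hpos : volume G ≠ 0 := (hGo.measure_pos volume hGne).ne'
  have hfin : volume G ≠ ⊤ := ((measure_mono (hGV.trans hVK)).trans_lt hK.measure_lt_top).ne
  rw [ENNReal.mul_le_mul_iff_left hpos hfin, ENNReal.ofReal_le_ofReal_iff'] at hle
  rcases hle with h | h <;> linarith

/-! ### Derivatives and Hessian determinant of the barrier. -/

section Barrier

variable {m : ℕ}

theorem Fin.last_succ_ne_zero : Fin.last (m + 1) ≠ 0 := (Fin.last_pos).ne'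

theorem Fin.succ_castSucc_ne_last (i : Fin m) : i.castSucc.succ ≠ Fin.last (m + 1) := by
  rw [Fin.succ_castSucc]
  exact (Fin.castSucc_lt_last _).ne

/-- A sum over the coordinates, split into the first, the middle and the last ones. -/
theorem sum_univ_first_middle_last (g : Fin (m + 2) → ℝ) :
    ∑ i, g i = g 0 + (∑ i : Fin m, g i.castSucc.succ) + g (Fin.last (m + 1)) := by
  rw [Fin.sum_univ_succ, Fin.sum_univ_castSucc, Fin.succ_last]
  exact (add_assoc _ _ _).symm

theorem prod_univ_first_middle_last (g : Fin (m + 2) → ℝ) :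
    ∏ i, g i = g 0 * (∏ i : Fin m, g i.castSucc.succ) * g (Fin.last (m + 1)) := by
  rw [Fin.prod_univ_succ, Fin.prod_univ_castSucc, Fin.succ_last]
  exact (mul_assoc _ _ _).symm

/-- The barrier `c + a |x''|² + b x₁² xₙ + f(xₙ)`. -/
def barrier (a b c : ℝ) (f : ℝ → ℝ) (x : EuclideanSpace ℝ (Fin (m + 2))) : ℝ :=
  c + a * middleNormSq x + b * x 0 ^ 2 * x (Fin.last (m + 1)) + f (x (Fin.last (m + 1)))

/-- The gradient of the barrier. -/
noncomputable def barrierGradient (a b : ℝ) (f' : ℝ → ℝ) (x : EuclideanSpace ℝ (Fin (m + 2))) :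
    EuclideanSpace ℝ (Fin (m + 2)) :=
  WithLp.toLp 2 fun i =>
    if i = 0 then 2 * b * x 0 * x (Fin.last (m + 1))
    else if i = Fin.last (m + 1) then b * x 0 ^ 2 + f' (x (Fin.last (m + 1)))
    else 2 * a * x i

/-- A symmetric matrix that is diagonal up to the corner entry `D`, with diagonal
`(A, α, …, α, B)`. -/
def cornerMatrix (m : ℕ) (α A B D : ℝ) : Matrix (Fin (m + 2)) (Fin (m + 2)) ℝ :=
  Matrix.of fun i j =>
    if i = 0 then if j = 0 then A else if j = Fin.last (m + 1) then D else 0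
    else if i = Fin.last (m + 1) then if j = 0 then D else if j = Fin.last (m + 1) then B else 0
    else if i = j then α else 0

theorem det_cornerMatrix {α A B D : ℝ} (hA : A ≠ 0) :
    (cornerMatrix m α A B D).det = α ^ m * (A * B - D ^ 2) := by
  have hl : Fin.last (m + 1) ≠ 0 := Fin.last_succ_ne_zero
  -- Subtracting `D / A` times the first row from the last clears the lower corner.
  rw [← Matrix.det_updateRow_add_smul_self (cornerMatrix m α A B D) hl (-(D / A)),
    Matrix.det_of_isUpperTriangular, prod_univ_first_middle_last]
  · have h1 : ∀ i : Fin m, i.castSucc.succ ≠ Fin.last (m + 1) := Fin.succ_castSucc_ne_last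
    simp [cornerMatrix, Matrix.updateRow_apply, hl, hl.symm, h1]
    field_simp
    ring
  · intro i j hij
    simp only [id] at hij
    have hi0 : i ≠ 0 := (Fin.zero_le j).trans_lt hij |>.ne'
    have hjl : j ≠ Fin.last (m + 1) := (hij.trans_le (Fin.le_last i)).ne
    rcases eq_or_ne i (Fin.last (m + 1)) with rfl | hil
    · rcases eq_or_ne j 0 with rfl | hj0
      · simp [cornerMatrix, hl]
        field_simp
        ring
      · simp [cornerMatrix, hl, hjl, hj0]
    · simp [cornerMatrix, Matrix.updateRow_apply, hil, hi0, hij.ne']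

theorem inner_eq_first_middle_last (x y : EuclideanSpace ℝ (Fin (m + 2))) :
    inner ℝ x y = x 0 * y 0 + (∑ i : Fin m, x i.castSucc.succ * y i.castSucc.succ)
      + x (Fin.last (m + 1)) * y (Fin.last (m + 1)) := by
  rw [PiLp.inner_apply, sum_univ_first_middle_last]
  simp [mul_comm]

theorem hasFDerivAt_coord (i : Fin (m + 2)) (x : EuclideanSpace ℝ (Fin (m + 2))) :
    HasFDerivAt (fun y : EuclideanSpace ℝ (Fin (m + 2)) => y i)
      (EuclideanSpace.proj (𝕜 := ℝ) i : EuclideanSpace ℝ (Fin (m + 2)) →L[ℝ] ℝ) x :=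
  (EuclideanSpace.proj (𝕜 := ℝ) i : EuclideanSpace ℝ (Fin (m + 2)) →L[ℝ] ℝ).hasFDerivAt

theorem hasFDerivAt_barrier (a b c : ℝ) {f f' : ℝ → ℝ} {x : EuclideanSpace ℝ (Fin (m + 2))}
    (hf : HasDerivAt f (f' (x (Fin.last (m + 1)))) (x (Fin.last (m + 1)))) :
    HasFDerivAt (barrier a b c f) (innerSL ℝ (barrierGradient a b f' x)) x := by
  have hmid : HasFDerivAt (middleNormSq (m := m)) _ x :=
    HasFDerivAt.fun_sum fun i _ => (hasFDerivAt_coord i.castSucc.succ x).pow 2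
  have hl : Fin.last (m + 1) ≠ 0 := Fin.last_succ_ne_zero
  have h := (((hmid.const_mul a).const_add c).add
    ((((hasFDerivAt_coord 0 x).pow 2).const_mul b).mul (hasFDerivAt_coord (Fin.last (m + 1)) x))).add
    (HasDerivAt.comp_hasFDerivAt x hf (hasFDerivAt_coord (Fin.last (m + 1)) x))
  refine h.congr_fderiv ?_
  ext v
  have h1 : ∀ i : Fin m, i.castSucc.succ ≠ Fin.last (m + 1) := Fin.succ_castSucc_ne_last
  simp only [innerSL_apply_apply, inner_eq_first_middle_last]
  simp [barrierGradient, hl, h1, Finset.mul_sum]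
  ring_nf

/-- The Hessian of the barrier. -/
noncomputable def barrierHessian (a b : ℝ) (f'' : ℝ → ℝ) (x : EuclideanSpace ℝ (Fin (m + 2))) :
    EuclideanSpace ℝ (Fin (m + 2)) →L[ℝ] EuclideanSpace ℝ (Fin (m + 2)) :=
  Matrix.toEuclideanCLM (𝕜 := ℝ) (cornerMatrix m (2 * a) (2 * b * x (Fin.last (m + 1)))
    (f'' (x (Fin.last (m + 1)))) (2 * b * x 0))

theorem barrierHessian_apply (a b : ℝ) (f'' : ℝ → ℝ) (x v : EuclideanSpace ℝ (Fin (m + 2)))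
    (i : Fin (m + 2)) : barrierHessian a b f'' x v i =
      if i = 0 then 2 * b * x (Fin.last (m + 1)) * v 0 + 2 * b * x 0 * v (Fin.last (m + 1))
      else if i = Fin.last (m + 1) then
        2 * b * x 0 * v 0 + f'' (x (Fin.last (m + 1))) * v (Fin.last (m + 1))
      else 2 * a * v i := by
  have hl : Fin.last (m + 1) ≠ 0 := Fin.last_succ_ne_zero
  have h1 : ∀ i : Fin m, i.castSucc.succ ≠ Fin.last (m + 1) := Fin.succ_castSucc_ne_last
  rw [barrierHessian, Matrix.ofLp_toEuclideanCLM, Matrix.mulVec, dotProduct]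
  split_ifs with h h'
  · subst h
    simp [sum_univ_first_middle_last, cornerMatrix, hl, h1]
  · subst h'
    simp [sum_univ_first_middle_last, cornerMatrix, hl, h1]
  · simp [cornerMatrix, h, h']

theorem hasFDerivAt_barrierGradient (a b : ℝ) {f' f'' : ℝ → ℝ} {x : EuclideanSpace ℝ (Fin (m + 2))}
    (hf : HasDerivAt f' (f'' (x (Fin.last (m + 1)))) (x (Fin.last (m + 1)))) :
    HasFDerivAt (barrierGradient a b f') (barrierHessian a b f'' x) x := by
  rw [← hasFDerivWithinAt_univ, hasFDerivWithinAt_piLp]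
  intro i
  rw [hasFDerivWithinAt_univ]
  have h0 := hasFDerivAt_coord 0 x
  have hn := hasFDerivAt_coord (Fin.last (m + 1)) x
  simp only [barrierGradient]
  split_ifs with h h'
  · refine ((h0.const_mul (2 * b)).mul hn).congr_fderiv ?_
    ext v
    simp [barrierHessian_apply, h]
    ring
  · refine (((h0.pow 2).const_mul b).add (HasDerivAt.comp_hasFDerivAt x hf hn)).congr_fderiv ?_
    ext v
    subst h'
    simp [barrierHessian_apply, h]
    ring
  · refine ((hasFDerivAt_coord i x).const_mul (2 * a)).congr_fderiv ?_
    ext v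
    simp [barrierHessian_apply, h, h']

/-- Where the Hessian of the barrier is positive semidefinite, its determinant is at most the
product of its diagonal entries. -/
theorem abs_det_barrierHessian_le {a b : ℝ} {f'' : ℝ → ℝ} {x : EuclideanSpace ℝ (Fin (m + 2))}
    (ha : 0 < a) (hA : 0 < 2 * b * x (Fin.last (m + 1)))
    (hpos : ∀ v, 0 ≤ inner ℝ (barrierHessian a b f'' x v) v) :
    |(barrierHessian a b f'' x).det| ≤
      (2 * a) ^ m * (2 * b * x (Fin.last (m + 1)) * f'' (x (Fin.last (m + 1)))) := by
  have hl : Fin.last (m + 1) ≠ 0 := Fin.last_succ_ne_zero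
  have h1 : ∀ i : Fin m, i.castSucc.succ ≠ Fin.last (m + 1) := Fin.succ_castSucc_ne_last
  set A := 2 * b * x (Fin.last (m + 1)) with hAdef
  set B := f'' (x (Fin.last (m + 1))) with hB
  set D := 2 * b * x 0 with hD
  have hdet : (barrierHessian a b f'' x).det = (2 * a) ^ m * (A * B - D ^ 2) := by
    rw [← det_cornerMatrix hA.ne']
    exact LinearMap.det_toLin (PiLp.basisFun 2 ℝ (Fin (m + 2))) _
  have hnonneg : 0 ≤ A * B - D ^ 2 := by
    -- The Hessian maps this vector to `(A B - D²) eₙ`, so the quadratic form equals `A (A B - D²)`.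
    have h := hpos (-D • EuclideanSpace.single 0 1 + A • EuclideanSpace.single (Fin.last (m + 1)) 1)
    rw [inner_eq_first_middle_last] at h
    simp [barrierHessian_apply, hl, hl.symm, h1] at h
    rw [← hAdef, ← hB, ← hD] at h
    have : 0 ≤ A * (A * B - D ^ 2) := by linarith
    exact nonneg_of_mul_nonneg_right this hA
  rw [hdet, abs_of_nonneg (by positivity)]
  gcongr
  nlinarith [sq_nonneg D]

end Barrier

/-! ### The box, and one-dimensional bounds on `u` along the normal. -/

section Box

variable {m : ℕ}

theorem norm_sq_first_middle_last (x : EuclideanSpace ℝ (Fin (m + 2))) :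
    ‖x‖ ^ 2 = x 0 ^ 2 + middleNormSq x + x (Fin.last (m + 1)) ^ 2 := by
  rw [EuclideanSpace.real_norm_sq_eq, sum_univ_first_middle_last]
  rfl

theorem middleNormSq_nonneg (x : EuclideanSpace ℝ (Fin (m + 2))) : 0 ≤ middleNormSq x :=
  Finset.sum_nonneg fun _ _ => sq_nonneg _

theorem continuous_middleNormSq : Continuous (middleNormSq (m := m)) := by
  unfold middleNormSq
  fun_prop

/-- The unit vector in the direction of `xₙ`. -/
noncomputable def lastUnit (m : ℕ) : EuclideanSpace ℝ (Fin (m + 2)) :=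
  EuclideanSpace.single (Fin.last (m + 1)) 1

@[simp] theorem lastUnit_last : lastUnit m (Fin.last (m + 1)) = 1 := by
  simp [lastUnit]

@[simp] theorem lastUnit_zero : lastUnit m 0 = 0 := by
  simp [lastUnit, Fin.last_succ_ne_zero.symm]

@[simp] theorem lastUnit_middle (i : Fin m) : lastUnit m i.castSucc.succ = 0 := by
  simp [lastUnit, Fin.succ_castSucc_ne_last i]

@[simp] theorem middleNormSq_add_smul_lastUnit (x : EuclideanSpace ℝ (Fin (m + 2))) (s : ℝ) :
    middleNormSq (x + s • lastUnit m) = middleNormSq x := by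
  simp [middleNormSq]

/-- The closed box `|x₁| ≤ 1/2`, `|x''| ≤ 1/2`, `0 ≤ xₙ ≤ 1/2`. -/
def closedBox (m : ℕ) : Set (EuclideanSpace ℝ (Fin (m + 2))) :=
  {x | |x 0| ≤ 1 / 2 ∧ middleNormSq x ≤ 1 / 4 ∧ 0 ≤ x (Fin.last (m + 1)) ∧
    x (Fin.last (m + 1)) ≤ 1 / 2}

/-- The open box `|x₁| < 1/2`, `|x''| < 1/2`, `0 < xₙ < 1/2`. -/
def openBox (m : ℕ) : Set (EuclideanSpace ℝ (Fin (m + 2))) :=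
  {x | |x 0| < 1 / 2 ∧ middleNormSq x < 1 / 4 ∧ 0 < x (Fin.last (m + 1)) ∧
    x (Fin.last (m + 1)) < 1 / 2}

theorem openBox_subset_closedBox : openBox m ⊆ closedBox m :=
  fun _ ⟨h₁, h₂, h₃, h₄⟩ => ⟨h₁.le, h₂.le, h₃.le, h₄.le⟩

theorem isOpen_openBox : IsOpen (openBox m) := by
  have := continuous_middleNormSq (m := m)
  simp only [openBox, ofPred_and]
  refine .inter ?_ (.inter ?_ (.inter ?_ ?_)) <;> exact isOpen_lt (by fun_prop) (by fun_prop)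

theorem norm_lt_one_of_mem_closedBox {x : EuclideanSpace ℝ (Fin (m + 2))} (hx : x ∈ closedBox m) :
    ‖x‖ < 1 := by
  obtain ⟨h₁, h₂, h₃, h₄⟩ := hx
  have h := norm_sq_first_middle_last x
  have : x 0 ^ 2 ≤ (1 / 2) ^ 2 := sq_le_sq' (neg_le_of_abs_le h₁) (le_of_abs_le h₁)
  nlinarith [norm_nonneg x]

theorem isCompact_closedBox : IsCompact (closedBox m) := by
  have := continuous_middleNormSq (m := m)
  refine Metric.isCompact_of_isClosed_isBounded ?_ ?_
  · simp only [closedBox, ofPred_and]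
    refine .inter ?_ (.inter ?_ (.inter ?_ ?_)) <;> exact isClosed_le (by fun_prop) (by fun_prop)
  · exact Metric.isBounded_ball.subset fun x hx =>
      mem_ball_zero_iff.mpr (norm_lt_one_of_mem_closedBox hx)

theorem mem_closure_unitHalfBall {x : EuclideanSpace ℝ (Fin (m + 2))} (hx : ‖x‖ < 1)
    (hn : 0 ≤ x (Fin.last (m + 1))) : x ∈ closure (unitHalfBall m) := by
  have hc : ContinuousAt (fun s : ℝ => x + s • lastUnit m) 0 := by fun_prop
  have ht : Tendsto (fun s : ℝ => x + s • lastUnit m) (𝓝[>] 0) (𝓝 x) := by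
    have := hc.tendsto
    simp only [zero_smul, add_zero] at this
    exact this.mono_left nhdsWithin_le_nhds
  refine mem_closure_of_tendsto ht ?_
  filter_upwards [ht.eventually (Metric.isOpen_ball.mem_nhds (mem_ball_zero_iff.mpr hx)),
    self_mem_nhdsWithin] with s hs hs0
  refine ⟨hs, ?_⟩
  have : 0 < s := hs0
  simp
  linarith

theorem openBox_subset_unitHalfBall : openBox m ⊆ unitHalfBall m := fun _ hx =>
  ⟨mem_ball_zero_iff.mpr (norm_lt_one_of_mem_closedBox (openBox_subset_closedBox hx)), hx.2.2.1⟩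

theorem closedBox_subset_closure : closedBox m ⊆ closure (unitHalfBall m) := fun _ hx =>
  mem_closure_unitHalfBall (norm_lt_one_of_mem_closedBox hx) hx.2.2.1

variable {u : EuclideanSpace ℝ (Fin (m + 2)) → ℝ}

/-- A bounded convex function grows at most linearly away from the flat boundary. -/
theorem le_of_convexOn_of_le_flat {H M₁ σ : ℝ} (hσ : 0 ≤ σ) (hM₁ : 0 ≤ M₁)
    (hconv : ConvexOn ℝ (closure (unitHalfBall m)) u) (hH : ∀ x ∈ unitHalfBall m, u x ≤ H)
    (hflat : ∀ x ∈ unitFlatBall m, u x ≤ σ + M₁ * middleNormSq x)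
    {x : EuclideanSpace ℝ (Fin (m + 2))} (hx : x ∈ closedBox m) :
    u x ≤ σ + M₁ * middleNormSq x + 2 * H * x (Fin.last (m + 1)) := by
  obtain ⟨h₁, h₂, h₃, h₄⟩ := hx
  set t := x (Fin.last (m + 1)) with ht
  set y := x + (-t) • lastUnit m with hy
  set z := x + (1 / 2 - t) • lastUnit m with hz
  have hyb : y ∈ closedBox m := by
    refine ⟨by simpa [hy] using h₁, ?_, by simp [hy, ← ht], by simp [hy, ← ht]⟩
    rwa [hy, middleNormSq_add_smul_lastUnit]
  have hzb : z ∈ closedBox m := by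
    refine ⟨by simpa [hz] using h₁, ?_, by simp [hz, ← ht], by simp [hz, ← ht]⟩
    rwa [hz, middleNormSq_add_smul_lastUnit]
  have hyf : y ∈ unitFlatBall m :=
    ⟨mem_ball_zero_iff.mpr (norm_lt_one_of_mem_closedBox hyb), by simp [hy, ← ht]⟩
  have hzh : z ∈ unitHalfBall m :=
    ⟨mem_ball_zero_iff.mpr (norm_lt_one_of_mem_closedBox hzb), by simp [hz, ← ht]⟩
  have hxyz : (1 - 2 * t) • y + (2 * t) • z = x := by
    rw [hy, hz]
    module
  have h := hconv.2 (closedBox_subset_closure hyb) (closedBox_subset_closure hzb)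
    (by linarith : 0 ≤ 1 - 2 * t) (by linarith : 0 ≤ 2 * t) (by ring)
  rw [hxyz, smul_eq_mul, smul_eq_mul] at h
  have hy' := hflat y hyf
  rw [hy, middleNormSq_add_smul_lastUnit, ← hy] at hy'
  have hq : 0 ≤ σ + M₁ * middleNormSq x := by
    have := middleNormSq_nonneg x
    positivity
  have hz' := hH z hzh
  nlinarith [mul_le_mul_of_nonneg_left hy' (by linarith : 0 ≤ 1 - 2 * t),
    mul_le_mul_of_nonneg_left hz' (by linarith : 0 ≤ 2 * t), mul_nonneg h₃ hq]

/-- A lower bound on the normal derivative at `0` bounds `u` from below along the normal. -/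
theorem le_of_lt_boundaryNormalDeriv (hu : ContinuousOn u (closure (unitHalfBall m))) {M : ℝ}
    (hD : ((-M : ℝ) : EReal) < boundaryNormalDeriv u (0 : EuclideanSpace ℝ (Fin (m + 2))))
    {t : ℝ} (ht : 0 < t) (ht1 : t < 1) : u 0 - M * t ≤ u (t • lastUnit m) := by
  have hnorm : ∀ s : ℝ, 0 ≤ s → ‖s • lastUnit m‖ = s := fun s hs => by
    simp [norm_smul, lastUnit, abs_of_nonneg hs]
  have hmem : t • lastUnit m ∈ unitHalfBall m :=
    ⟨mem_ball_zero_iff.mpr ((hnorm t ht.le).trans_lt ht1), by simpa using ht⟩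
  -- The limsup yields good slopes only at arbitrarily small heights `s`, which suffices for letting
  -- `s → 0`.
  have hfreq : ∃ᶠ s : ℝ in 𝓝[>] 0, u (s • lastUnit m) - M * (t - s) ≤ u (t • lastUnit m) := by
    have h := frequently_lt_of_lt_limsup (by isBoundedDefault) hD
    have hst : ∀ᶠ s : ℝ in 𝓝[>] 0, s < t := nhdsWithin_le_nhds (gt_mem_nhds ht)
    refine (h.and_eventually hst).mono fun s ⟨hs, hst⟩ => ?_
    rw [upperNormalDerivOn] at hs
    simp only [lt_iSup_iff, EReal.coe_lt_coe_iff, zero_add] at hs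
    obtain ⟨p, hp, hMp⟩ := hs
    have h1 := hp _ hmem
    change u (s • lastUnit m) + inner ℝ p (t • lastUnit m - s • lastUnit m) ≤ _ at h1
    rw [← sub_smul, inner_eq_first_middle_last] at h1
    simp at h1
    nlinarith [mul_le_mul_of_nonneg_right hMp.le (sub_pos.mpr hst).le]
  have h0 : (0 : EuclideanSpace ℝ (Fin (m + 2))) ∈ closure (unitHalfBall m) :=
    mem_closure_unitHalfBall (by simp) (by simp)
  have hlim : Tendsto (fun s : ℝ => s • lastUnit m) (𝓝[>] 0) (𝓝[closure (unitHalfBall m)] 0) := by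
    refine tendsto_nhdsWithin_iff.mpr ⟨?_, ?_⟩
    · have : ContinuousAt (fun s : ℝ => s • lastUnit m) 0 := by fun_prop
      have := this.tendsto
      rw [zero_smul] at this
      exact this.mono_left nhdsWithin_le_nhds
    · have h1 : ∀ᶠ s : ℝ in 𝓝[>] 0, s < 1 := nhdsWithin_le_nhds (gt_mem_nhds one_pos)
      filter_upwards [h1, self_mem_nhdsWithin] with s hs hs0
      have hs0' : 0 < s := hs0
      exact mem_closure_unitHalfBall ((hnorm s hs0'.le).trans_lt hs) (by simpa using hs0'.le)
  have hlim2 : Tendsto (fun s : ℝ => M * (t - s)) (𝓝[>] 0) (𝓝 (M * t)) := by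
    have : ContinuousAt (fun s : ℝ => M * (t - s)) 0 := by fun_prop
    have := this.tendsto
    rw [sub_zero] at this
    exact this.mono_left nhdsWithin_le_nhds
  exact le_of_tendsto_of_frequently (((hu 0 h0).tendsto.comp hlim).sub hlim2) hfreq

end Box

/-! ### The logarithmic profile and the upper bound for `u`. -/

/-- The dependence of the barrier on `xₙ`, with a slope tending to `-∞` at `0` as `σ → 0`. -/
noncomputable def logProfile (κ σ C s : ℝ) : ℝ := κ * (s * Real.log (2 * (s + σ))) + C * s

theorem hasDerivAt_logProfile (κ C : ℝ) {σ s : ℝ} (h : 0 < s + σ) :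
    HasDerivAt (logProfile κ σ C)
      (κ * (Real.log (2 * (s + σ)) + s / (s + σ)) + C) s := by
  have h1 : HasDerivAt (fun s => 2 * (s + σ)) 2 s := by
    simpa using ((hasDerivAt_id s).add_const σ).const_mul 2
  have h2 := h1.log (by positivity)
  refine ((((hasDerivAt_id s).mul h2).const_mul κ).add ((hasDerivAt_id s).const_mul C)).congr_deriv ?_
  simp only [id]
  field_simp

theorem hasDerivAt_deriv_logProfile (κ C : ℝ) {σ s : ℝ} (h : 0 < s + σ) :
    HasDerivAt (fun s => κ * (Real.log (2 * (s + σ)) + s / (s + σ)) + C)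
      (κ * (1 / (s + σ) + σ / (s + σ) ^ 2)) s := by
  have h0 : HasDerivAt (fun s => s + σ) 1 s := (hasDerivAt_id s).add_const σ
  have h1 : HasDerivAt (fun s => 2 * (s + σ)) 2 s := by simpa using h0.const_mul 2
  have h2 := h1.log (by positivity)
  refine (((h2.add ((hasDerivAt_id s).div h0 h.ne')).const_mul κ).add_const C).congr_deriv ?_
  simp only [id]
  field_simp
  ring

theorem continuousOn_logProfile (κ C : ℝ) {σ : ℝ} (hσ : 0 < σ) :
    ContinuousOn (logProfile κ σ C) (Ici 0) := fun s hs =>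
  (hasDerivAt_logProfile κ C (by have : 0 ≤ s := hs; positivity)).continuousAt.continuousWithinAt

section UpperBound

variable {m : ℕ} {u : EuclideanSpace ℝ (Fin (m + 2)) → ℝ}

theorem le_barrier_of_mem_closedBox_diff {H M₁ σ κ : ℝ} (hM₁ : 0 ≤ M₁) (hσ : 0 < σ) (hκ : 0 ≤ κ)
    (hκM : κ ≤ M₁ / 2) (hσ1 : σ ≤ 1 / 2)
    (hu : ∀ x ∈ closedBox m, u x ≤ σ + M₁ * middleNormSq x + 2 * H * x (Fin.last (m + 1)))
    {x : EuclideanSpace ℝ (Fin (m + 2))} (hx : x ∈ closedBox m \ openBox m) :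
    u x ≤ barrier (2 * M₁) (4 * (κ * -Real.log (2 * σ))) σ (logProfile κ σ (2 * H)) x := by
  obtain ⟨hxb, hxo⟩ := hx
  refine (hu x hxb).trans ?_
  obtain ⟨h₁, h₂, h₃, h₄⟩ := hxb
  have hq := middleNormSq_nonneg x
  set t := x (Fin.last (m + 1)) with ht
  have hL : 0 ≤ -Real.log (2 * σ) := by
    have := Real.log_nonpos (by positivity : 0 ≤ 2 * σ) (by linarith)
    linarith
  have hmono : Real.log (2 * σ) ≤ Real.log (2 * (t + σ)) :=
    Real.log_le_log (by positivity) (by linarith)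
  suffices h : 0 ≤ M₁ * middleNormSq x + 4 * (κ * -Real.log (2 * σ)) * x 0 ^ 2 * t
      + κ * (t * Real.log (2 * (t + σ))) by
    rw [barrier, logProfile, ← ht]
    linarith
  have hMq : 0 ≤ M₁ * middleNormSq x := by positivity
  have hK : 0 ≤ 4 * (κ * -Real.log (2 * σ)) * x 0 ^ 2 * t := by positivity
  have hcases : 1 / 2 ≤ |x 0| ∨ 1 / 4 ≤ middleNormSq x ∨ t ≤ 0 ∨ 1 / 2 ≤ t := by
    by_contra! hc
    exact hxo hc
  rcases hcases with h | h | h | h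
  -- Here `b x₁² = -κ log(2σ)`, which is why `b` carries the factor 4.
  · have hx0 : x 0 ^ 2 = 1 / 4 := by
      rw [← sq_abs, le_antisymm h₁ h]
      norm_num
    rw [hx0]
    have := mul_nonneg (mul_nonneg hκ h₃) (sub_nonneg.mpr hmono)
    linarith
  -- The spare `M₁|x''|² ≥ M₁/4` of the doubled coefficient absorbs a loss of at most `κ/2`, as `κ ≤
  -- M₁/2`.
  · have hlog : -(1 / 2) ≤ t * Real.log (2 * (t + σ)) := by
      rcases h₃.eq_or_lt with h0 | h0
      · rw [← h0]
        norm_num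
      · have h1 := Real.one_sub_inv_le_log_of_pos (by positivity : 0 < 2 * (t + σ))
        have h2 := mul_le_mul_of_nonneg_left h1 h₃
        have h3 : t * (2 * (t + σ))⁻¹ ≤ 1 / 2 := by
          rw [← div_eq_mul_inv, div_le_iff₀ (by positivity)]
          linarith
        linarith
    have h1 := mul_le_mul_of_nonneg_left hlog hκ
    have h2 := mul_le_mul_of_nonneg_left h hM₁
    linarith
  · rw [le_antisymm h h₃]
    simpa using hMq
  · have : 0 ≤ Real.log (2 * (t + σ)) := Real.log_nonneg (by linarith)
    positivity

/-- The diagonal entry `2b xₙ` vanishes at the flat boundary and compensates the growth of `f''`, of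
order `κ / (xₙ + σ)`; the product is bounded uniformly in `xₙ`. -/
theorem le_barrier {lam H M₁ σ κ : ℝ} (hM₁ : 0 < M₁) (hσ : 0 < σ) (hκ : 0 < κ)
    (hκM : κ ≤ M₁ / 2) (hσ1 : σ < 1 / 2) (hlam : 0 < lam)
    (hdet : (2 * (2 * M₁)) ^ m * (16 * (κ ^ 2 * -Real.log (2 * σ))) < lam)
    (hcont : ContinuousOn u (closure (unitHalfBall m)))
    (hMA : ∀ E, MeasurableSet E → E ⊆ unitHalfBall m →
      ENNReal.ofReal lam * volume E ≤ mongeAmpereOn (unitHalfBall m) u E)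
    (hu : ∀ x ∈ closedBox m, u x ≤ σ + M₁ * middleNormSq x + 2 * H * x (Fin.last (m + 1))) :
    ∀ x ∈ closedBox m,
      u x ≤ barrier (2 * M₁) (4 * (κ * -Real.log (2 * σ))) σ (logProfile κ σ (2 * H)) x := by
  have hL : 0 < -Real.log (2 * σ) := by
    have := Real.log_neg (by positivity : 0 < 2 * σ) (by linarith)
    linarith
  refine le_of_mongeAmpereOn_ge isCompact_closedBox closedBox_subset_closure isOpen_openBox
    openBox_subset_closedBox openBox_subset_unitHalfBall hcont ?_ hMA hlam hdet
    (fun x hx => le_barrier_of_mem_closedBox_diff hM₁.le hσ hκ.le hκM hσ1.le hu hx)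
    (fun x hx => hasFDerivAt_barrier _ _ _ (hasDerivAt_logProfile κ _ (add_pos hx.2.2.1 hσ)))
    (fun x hx => hasFDerivAt_barrierGradient _ _
      (f'' := fun s => κ * (1 / (s + σ) + σ / (s + σ) ^ 2))
      (hasDerivAt_deriv_logProfile κ _ (add_pos hx.2.2.1 hσ))) fun x hx hpos => ?_
  · have hmid := continuous_middleNormSq (m := m)
    have hf : ContinuousOn (fun x : EuclideanSpace ℝ (Fin (m + 2)) =>
        logProfile κ σ (2 * H) (x (Fin.last (m + 1)))) (closedBox m) :=
      (continuousOn_logProfile κ (2 * H) hσ).comp (by fun_prop) fun x hx => hx.2.2.1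
    unfold barrier
    exact ContinuousOn.add (by fun_prop) hf
  · have ht : 0 < x (Fin.last (m + 1)) := hx.2.2.1
    refine (abs_det_barrierHessian_le (by positivity) (by positivity) hpos).trans ?_
    set t := x (Fin.last (m + 1))
    refine mul_le_mul_of_nonneg_left ?_ (by positivity)
    have h1 : t * (1 / (t + σ) + σ / (t + σ) ^ 2) ≤ 2 := by
      have h2 : t * (1 / (t + σ) + σ / (t + σ) ^ 2) = (t ^ 2 + 2 * (t * σ)) / (t + σ) ^ 2 := by
        field_simp
        ring
      rw [h2, div_le_iff₀ (by positivity)]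
      nlinarith [mul_pos ht hσ]
    have h3 : 0 ≤ 8 * κ ^ 2 * -Real.log (2 * σ) := by positivity
    have h4 := mul_le_mul_of_nonneg_left h1 h3
    calc _ = 8 * κ ^ 2 * -Real.log (2 * σ) * (t * (1 / (t + σ) + σ / (t + σ) ^ 2)) := by ring
      _ ≤ _ := h4
      _ = _ := by ring

end UpperBound

/-! ### Choice of parameters and conclusion. -/

/-- For `T` large, `κ` of order `1/T` and `σ` of order `exp (-T²)` the slope of the logarithmic
profile near `0` is below any given `-N`. -/
theorem exists_logProfile_parameters {c M N : ℝ} (hc : 0 < c) (hM : 0 < M) (hN : 0 < N) :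
    ∃ κ σ t : ℝ, 0 < κ ∧ κ ≤ M ∧ 0 < σ ∧ σ < 1 / 2 ∧ 0 < t ∧ t ≤ 1 / 2 ∧ σ ≤ t ∧
      κ ^ 2 * -Real.log (2 * σ) = c ∧ κ * Real.log (2 * (t + σ)) < -N := by
  set r := √c with hr
  have hr0 : 0 < r := Real.sqrt_pos.mpr hc
  have hrc : r ^ 2 = c := Real.sq_sqrt hc.le
  -- `T ≥ 2` makes `log 2 - T²/2 ≤ -T²/4`, `T ≥ r/M` gives `κ = r/T ≤ M`, and the last bound makes
  -- the slope `-rT/4` less than `-N`.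
  obtain ⟨T, hT2, hTM, hTN⟩ : ∃ T : ℝ, 2 ≤ T ∧ r / M ≤ T ∧ 4 * N / r < T := by
    refine ⟨2 + r / M + 4 * N / r, ?_, ?_, ?_⟩ <;>
      linarith [div_pos hr0 hM, div_pos (mul_pos four_pos hN) hr0]
  have hT : 0 < T := by linarith
  have hsplit : Real.exp (-T ^ 2) = Real.exp (-T ^ 2 / 2) * Real.exp (-T ^ 2 / 2) := by
    rw [← Real.exp_add]
    ring_nf
  have he : Real.exp (-T ^ 2 / 2) < 1 := Real.exp_lt_one_iff.mpr (by nlinarith)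
  have he0 := Real.exp_pos (-T ^ 2 / 2)
  have hle : Real.exp (-T ^ 2) / 2 ≤ Real.exp (-T ^ 2 / 2) / 2 := by
    rw [hsplit]
    nlinarith
  refine ⟨r / T, Real.exp (-T ^ 2) / 2, Real.exp (-T ^ 2 / 2) / 2, by positivity, ?_, by positivity,
    by linarith, by positivity, by linarith, hle, ?_, ?_⟩
  · rw [div_le_iff₀ hM] at hTM
    rw [div_le_iff₀ hT]
    linarith
  · rw [mul_div_cancel₀ _ two_ne_zero, Real.log_exp, div_pow, hrc]
    field_simp
  · have hlog : Real.log (2 * (Real.exp (-T ^ 2 / 2) / 2 + Real.exp (-T ^ 2) / 2)) ≤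
        -(T ^ 2 / 4) := by
      have h1 : Real.log (2 * (Real.exp (-T ^ 2 / 2) / 2 + Real.exp (-T ^ 2) / 2)) ≤
          Real.log (2 * Real.exp (-T ^ 2 / 2)) := Real.log_le_log (by positivity) (by linarith)
      rw [Real.log_mul two_ne_zero he0.ne', Real.log_exp] at h1
      nlinarith [Real.log_two_lt_d9]
    have h2 : r / T * -(T ^ 2 / 4) = -(r * T / 4) := by
      field_simp
    rw [div_lt_iff₀ hr0] at hTN
    calc _ ≤ r / T * -(T ^ 2 / 4) := by gcongr
      _ < -N := by rw [h2]; linarith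

theorem lemma4p1 (m : ℕ) (lam Lam H M₁ M₂ : ℝ) (hlam : 0 < lam) (hLam : 0 < Lam)
    (hH : 0 < H) (hM₁ : 0 < M₁) (hM₂ : 0 < M₂) :
    ∃ σ : ℝ, 0 < σ ∧ ∀ u : EuclideanSpace ℝ (Fin (m + 2)) → ℝ,
      ContinuousOn u (closure (unitHalfBall m)) →
      ConvexOn ℝ (closure (unitHalfBall m)) u →
      DetHessianBetween (unitHalfBall m) u lam Lam →
      (∀ x ∈ unitFlatBall m, ((-M₂ : ℝ) : EReal) ≤ boundaryNormalDeriv u x) →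
      (∀ x ∈ unitFlatBall m, 0 ≤ u x ∧ u x ≤ σ + M₁ * middleNormSq x) →
      H ≤ sSup (u '' unitHalfBall m) := by
  -- With this value the determinant bound of `le_barrier` equals `lam / 2`.
  set c := lam / (32 * (2 * (2 * M₁)) ^ m) with hc
  obtain ⟨κ, σ, t, hκ, hκM, hσ, hσ1, ht, ht1, hσt, hκc, hslope⟩ :=
    exists_logProfile_parameters (c := c) (M := M₁ / 2) (N := 2 * H + M₂ + 2) (by positivity)
      (by positivity) (by positivity)
  refine ⟨σ, hσ, fun u hcont hconv hMA hD hflat => ?_⟩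
  by_contra! hlt
  have hcomp : IsCompact (closure (unitHalfBall m)) :=
    (Metric.isBounded_ball.subset fun x hx => hx.1).isCompact_closure
  -- A real `sSup` controls the values only on a set that is bounded above.
  have hbdd : BddAbove (u '' unitHalfBall m) :=
    (hcomp.bddAbove_image hcont).mono (image_mono subset_closure)
  have hlin := fun x hx => le_of_convexOn_of_le_flat (u := u) (x := x) hσ.le hM₁.le hconv
    (fun x hx => (le_csSup hbdd (mem_image_of_mem u hx)).trans hlt.le) (fun x hx => (hflat x hx).2) hx
  have hdet : (2 * (2 * M₁)) ^ m * (16 * (κ ^ 2 * -Real.log (2 * σ))) < lam := by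
    have h1 : (2 * (2 * M₁)) ^ m * (16 * (κ ^ 2 * -Real.log (2 * σ))) = lam / 2 := by
      rw [hκc, hc]
      field_simp
      norm_num
    linarith
  have h0 : (0 : EuclideanSpace ℝ (Fin (m + 2))) ∈ unitFlatBall m := ⟨by simp, by simp⟩
  have hbox : t • lastUnit m ∈ closedBox m := by
    refine ⟨by simp, ?_, by simpa using ht.le, by simpa using ht1⟩
    simp [middleNormSq]
  have hupper := le_barrier hM₁ hσ hκ hκM hσ1 hlam hdet hcont
    (fun E hE hEΩ => (hMA E hE hEΩ).1) hlin _ hbox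
  -- Giving up 1 makes the inequality strict, as extracting slopes from the limsup requires.
  have hDlt : ((-(M₂ + 1) : ℝ) : EReal) < boundaryNormalDeriv u 0 :=
    (EReal.coe_lt_coe_iff.mpr (by linarith)).trans_le (hD 0 h0)
  have hlower := le_of_lt_boundaryNormalDeriv hcont hDlt ht (by linarith)
  have hu0 := (hflat 0 h0).1
  have hval : barrier (2 * M₁) (4 * (κ * -Real.log (2 * σ))) σ (logProfile κ σ (2 * H))
      (t • lastUnit m) = σ + t * (κ * Real.log (2 * (t + σ))) + 2 * H * t := by
    simp [barrier, middleNormSq, logProfile]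
    ring
  rw [hval] at hupper
  -- Now `-(M₂ + 1) t ≤ u(t eₙ) < σ - (M₂ + 2) t` forces `t < σ`, contrary to `σ ≤ t`.
  nlinarith [mul_lt_mul_of_pos_left hslope ht]
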